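/- Let $\ell^2$ be the complex Hilbert space of square summable sequences indexed by $\mathbb Z_+=\{0,1,2,\dots\}$, with standard orthonormal basis $(e_n)_{n\ge 0}$. Let $\lambda=(\lambda_n)_{n\ge 0}$ be a bounded sequence of positive real numbers, and let $W_\lambda$ be the bounded operator on $\ell^2$ with $W_\lambda e_n=\lambda_n e_{n+1}$ for all $n\ge 0$. Put $\hat\lambda_0=1$ and $\hat\lambda_n=\lambda_0^2\cdots\lambda_{n-1}^2$ for $n\ge 1$. For $n\in\mathbb Z_+$ let $Q_n$ be the polynomial with $Q_0=Q_1=0$ and $Q_n(x)=\sum_{j=0}^{n-2}(n-j-1)x^j$ for $n\ge 2$. A bounded operator $T$ on a complex Hilbert space $H$ is *subnormal* if there are a complex Hilbert space $K$ containing $H$ (isometrically embedded) and a bounded normal operator $N$ on $K$ with $Th=Nh$ for all $h\in H$. It is *conditionally positive definite* (CPD) if for every $h\in H$ the sequence $\gamma_n=\|T^nh\|^2$ satisfies $\sum_{i,j=0}^k\gamma_{i+j}z_i\bar z_j\ge 0$ for all $k\ge 0$ and all $z_0,\dots,z_k\in\mathbb C$ with $\sum_{j=0}^k z_j=0$. A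 *scalar representing triplet* of $W_\lambda$ is a triplet $(b,c,\nu)$, where $b\in\mathbb R$, $c\in[0,\infty)$ and $\nu$ is a finite compactly supported positive Borel measure on $\mathbb R_+=[0,\infty)$ with $\nu(\{1\})=0$, such that $$\hat\lambda_n=1+bn+cn^2+\int_{\mathbb R_+}Q_n\,d\nu\qquad\text{for all } n\in\mathbb Z_+ .$$ **Proposition.** The following are equivalent: 1. $W_\lambda$ is subnormal; 2. $W_\lambda$ is CPD and has a scalar representing triplet $(b,c,\nu)$ such that - $\int_{\mathbb R_+}\frac{1}{(x-1)^2}\,d\nu(x)\le 1$, - $b=\int_{\mathbb R_+}\frac{1}{x-1}\,d\nu(x)$ (this integral exists by the preceding condition), - $c=0$. -/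

import Mathlib

open MeasureTheory
open scoped NNReal ENNReal ComplexOrder

/-- The complex Hilbert space of square summable sequences indexed by the nonnegative integers. -/
abbrev EllTwo : Type := lp (fun _ : ℕ => ℂ) 2

/-- The standard orthonormal basis vectors of `EllTwo`. -/
noncomputable def stdVec (n : ℕ) : EllTwo := lp.single 2 n (1 : ℂ)

/-- A real sequence `γ` is conditionally positive definite if
`∑_{i,j ≤ k} γ (i + j) * z i * conj (z j) ≥ 0` (as a complex number: real and nonnegative)
for all `z 0, …, z k` in `ℂ` with `z 0 + ⋯ + z k = 0`. -/
def IsCPDSeq (γ : ℕ → ℝ) : Prop :=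
  ∀ (k : ℕ) (z : ℕ → ℂ), ∑ j ∈ Finset.range (k + 1), z j = 0 →
    (0 : ℂ) ≤ ∑ i ∈ Finset.range (k + 1), ∑ j ∈ Finset.range (k + 1),
      (γ (i + j) : ℂ) * z i * (starRingEnd ℂ) (z j)

/-- A bounded operator `T` on a complex Hilbert space is conditionally positive definite if
all the sequences `n ↦ ‖T ^ n h‖ ^ 2` are. -/
def IsCPDOperator {H : Type*} [NormedAddCommGroup H] [InnerProductSpace ℂ H]
    (T : H →L[ℂ] H) : Prop :=
  ∀ h : H, IsCPDSeq (fun n => ‖(T ^ n) h‖ ^ 2)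

/-- A bounded operator `T` on a complex Hilbert space `H` is subnormal if `H` embeds
isometrically in a complex Hilbert space `K` that carries a bounded normal operator
extending `T`. -/
def IsSubnormalOperator.{u} {H : Type u} [NormedAddCommGroup H] [InnerProductSpace ℂ H]
    (T : H →L[ℂ] H) : Prop :=
  ∃ (K : Type u) (_ : NormedAddCommGroup K) (_ : InnerProductSpace ℂ K) (_ : CompleteSpace K)
    (J : H →ₗᵢ[ℂ] K) (N : K →L[ℂ] K), IsStarNormal N ∧ ∀ h : H, N (J h) = J (T h)

/-- The sequence `(0, w 0 * x 0, w 1 * x 1, …)`. -/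
def shiftSeq (w : ℕ → ℝ) (x : ℕ → ℂ) : ℕ → ℂ
  | 0 => 0
  | n + 1 => (w n : ℂ) * x n

theorem hasSum_norm_sq_ellTwo (x : EllTwo) : HasSum (fun n => ‖x n‖ ^ 2) (‖x‖ ^ 2) := by
  simpa using lp.hasSum_norm (p := 2) (by norm_num) x

theorem norm_shiftSeq_succ_sq_le {w : ℕ → ℝ} {M : ℝ} (hM : ∀ n, |w n| ≤ M) (x : ℕ → ℂ)
    (n : ℕ) : ‖shiftSeq w x (n + 1)‖ ^ 2 ≤ M ^ 2 * ‖x n‖ ^ 2 := by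
  have h : ‖shiftSeq w x (n + 1)‖ = |w n| * ‖x n‖ := by simp [shiftSeq]
  rw [h, mul_pow]
  gcongr
  exact hM n

theorem memℓp_shiftSeq {w : ℕ → ℝ} {M : ℝ} (hM : ∀ n, |w n| ≤ M) (x : EllTwo) :
    Memℓp (shiftSeq w x) 2 := by
  refine memℓp_gen ?_
  have h : Summable fun n => ‖shiftSeq w x n‖ ^ 2 := by
    rw [← summable_nat_add_iff 1]
    exact Summable.of_nonneg_of_le (fun n => by positivity) (norm_shiftSeq_succ_sq_le hM x)
      ((hasSum_norm_sq_ellTwo x).summable.mul_left _)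
  simpa using h

/-- The weighted shift `(x 0, x 1, …) ↦ (0, w 0 * x 0, w 1 * x 1, …)` on `EllTwo`,
for a bounded sequence `w` of weights. -/
noncomputable def weightedShift (w : ℕ → ℝ) (hw : ∃ M, ∀ n, |w n| ≤ M) : EllTwo →L[ℂ] EllTwo :=
  LinearMap.mkContinuousOfExistsBound
    { toFun := fun x => ⟨shiftSeq w x, memℓp_shiftSeq hw.choose_spec x⟩
      map_add' := fun x y => by
        ext n
        change shiftSeq w (x + y : EllTwo) n = shiftSeq w x n + shiftSeq w y n
        cases n <;> simp [shiftSeq, mul_add]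
      map_smul' := fun a x => by
        ext n
        cases n <;> simp [shiftSeq, mul_left_comm] }
    (by
      obtain ⟨M, hM⟩ := hw
      have hM0 : 0 ≤ M := (abs_nonneg _).trans (hM 0)
      refine ⟨M, fun x => ?_⟩
      set y : EllTwo := ⟨shiftSeq w x, memℓp_shiftSeq hM x⟩ with hy
      change ‖y‖ ≤ M * ‖x‖
      refine le_of_sq_le_sq ?_ (by positivity)
      have h1 := hasSum_norm_sq_ellTwo y
      rw [← hasSum_nat_add_iff' 1] at h1
      have h2 := hasSum_le (norm_shiftSeq_succ_sq_le hM x) h1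
        ((hasSum_norm_sq_ellTwo x).mul_left (M ^ 2))
      simpa [hy, shiftSeq, mul_pow] using h2)

theorem weightedShift_apply_zero (w : ℕ → ℝ) (hw : ∃ M, ∀ n, |w n| ≤ M) (x : EllTwo) :
    weightedShift w hw x 0 = 0 := rfl

theorem weightedShift_apply_succ (w : ℕ → ℝ) (hw : ∃ M, ∀ n, |w n| ≤ M) (x : EllTwo) (n : ℕ) :
    weightedShift w hw x (n + 1) = (w n : ℂ) * x n := rfl

theorem weightedShift_stdVec (w : ℕ → ℝ) (hw : ∃ M, ∀ n, |w n| ≤ M) (n : ℕ) :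
    weightedShift w hw (stdVec n) = (w n : ℂ) • stdVec (n + 1) := by
  ext k
  rw [lp.coeFn_smul, Pi.smul_apply]
  cases k with
  | zero => simp [weightedShift_apply_zero, stdVec]
  | succ k =>
    rw [weightedShift_apply_succ]
    by_cases h : k = n
    · subst h; simp [stdVec]
    · simp [stdVec, h]

/-- The formal moment sequence: `1` for `n = 0` and `w 0 ^ 2 * ⋯ * w (n - 1) ^ 2` for `n ≥ 1`. -/
def formalMoment (w : ℕ → ℝ) (n : ℕ) : ℝ := ∏ i ∈ Finset.range n, w i ^ 2

/-- The polynomial `Q n`: it is `0` for `n = 0, 1` (empty sum) and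
`∑_{j = 0}^{n - 2} (n - j - 1) * x ^ j` for `n ≥ 2`. -/
def polyQ (n : ℕ) (x : ℝ) : ℝ := ∑ j ∈ Finset.range (n - 1), ((n : ℝ) - j - 1) * x ^ j

/-- `(b, c, ν)` is the scalar representing triplet of the weighted shift with weights `w`:
`c ≥ 0`, `ν` is a finite compactly supported Borel measure on `[0, ∞)` without an atom at `1`,
and the formal moment at `n` equals `1 + b n + c n² + ∫ Q n dν` for all `n`. (The polynomials
`Q n` are `ν`-integrable since `ν` is finite with compact support.) -/
structure IsScalarRepresentingTriplet (w : ℕ → ℝ) (b c : ℝ) (ν : Measure ℝ≥0) : Prop where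
  nonneg : 0 ≤ c
  finite : IsFiniteMeasure ν
  compact_support : IsCompact ν.support
  no_atom_one : ν {1} = 0
  moment : ∀ n : ℕ, formalMoment w n = 1 + b * n + c * (n : ℝ) ^ 2 + ∫ x, polyQ n (x : ℝ) ∂ν

/-! Both conditions are equivalent to the existence of a Berger measure μ, a compactly supported
measure with moments λ̂_n.

If N is a normal extension, then ‖Nⁿk‖² = ⟪k, (N*N)ⁿk⟫, so Riesz representation of f ↦ ⟪k, f(N*N)k⟫
with k the image of e_0 yields μ. The same identity makes these sequences Gram kernels, hence CPD.

Berger measures and triplets are matched by (x - 1)² Q_n(x) = xⁿ - 1 - n(x - 1): take dν = (x - 1)²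
dμ, and conversely dμ = (x - 1)⁻² dν plus an atom at 1 that brings the mass to 1. The bound on ∫ (x
- 1)⁻² dν says that this atom is nonnegative.

Given μ, multiplication by z = √x e^{2πit} on L²(μ × Haar) is normal. The powers zⁿ are orthogonal
with squared norms λ̂_n, so after normalisation z shifts them exactly as the weighted shift does. -/

/-- `μ` is a finite Borel measure on `[0, ∞)`, carried by a bounded interval, whose moments are
the formal moments of the weighted shift with weights `w`. -/
structure IsBergerMeasure (w : ℕ → ℝ) (μ : Measure ℝ≥0) : Prop where
  finite : IsFiniteMeasure μ
  bounded : ∃ R : ℝ≥0, ∀ᵐ x ∂μ, x ≤ R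
  moment : ∀ n : ℕ, formalMoment w n = ∫ x, (x : ℝ) ^ n ∂μ

/-! ### Moment measures of normal operators -/

section NormalOperator

variable {K : Type*} [NormedAddCommGroup K] [InnerProductSpace ℂ K] [CompleteSpace K]

theorem inner_star_mul_self_pow (N : K →L[ℂ] K) [IsStarNormal N] (k : K) (n : ℕ) :
    inner ℂ k (((star N * N) ^ n) k) = ((‖(N ^ n) k‖ ^ 2 : ℝ) : ℂ) := by
  have hc : (star N * N) ^ n = star (N ^ n) * N ^ n := by
    rw [(show Commute (star N) N from star_comm_self' N).mul_pow, star_pow]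
  rw [hc, mul_apply_eq_comp, ContinuousLinearMap.star_eq_adjoint,
    ContinuousLinearMap.adjoint_inner_right, inner_self_eq_norm_sq_to_K]
  simp

/-- With A = N*N self-adjoint, the kernel at (i, j) is the Gram kernel of the vectors A^j k, so the
double sum equals ‖∑ z_j A^j k‖². -/
theorem isCPDSeq_norm_pow_sq (N : K →L[ℂ] K) [IsStarNormal N] (k : K) :
    IsCPDSeq (fun n => ‖(N ^ n) k‖ ^ 2) := by
  intro m z _
  set A := star N * N with hA
  have hsa : ∀ n, star (A ^ n) = A ^ n := fun n => by
    rw [star_pow, hA, star_mul, star_star]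
  have hg : ∀ i j, ((‖(N ^ (i + j)) k‖ ^ 2 : ℝ) : ℂ) = inner ℂ ((A ^ j) k) ((A ^ i) k) := by
    intro i j
    rw [← inner_star_mul_self_pow, ← ContinuousLinearMap.adjoint_inner_right,
      ← ContinuousLinearMap.star_eq_adjoint, hsa, ← mul_apply_eq_comp, ← pow_add,
      add_comm]
  have key : ∑ i ∈ Finset.range (m + 1), ∑ j ∈ Finset.range (m + 1),
      ((‖(N ^ (i + j)) k‖ ^ 2 : ℝ) : ℂ) * z i * (starRingEnd ℂ) (z j) =
      inner ℂ (∑ j ∈ Finset.range (m + 1), z j • (A ^ j) k)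
        (∑ i ∈ Finset.range (m + 1), z i • (A ^ i) k) := by
    simp only [hg, inner_sum, sum_inner, inner_smul_left, inner_smul_right, Finset.mul_sum]
    refine Finset.sum_congr rfl fun i _ => Finset.sum_congr rfl fun j _ => ?_
    ring
  beta_reduce
  rw [key, inner_self_eq_norm_sq_to_K]
  exact pow_nonneg (RCLike.ofReal_nonneg.2 (norm_nonneg _)) 2

/-- The functional `f ↦ ⟪k, f(A) k⟫` on nonnegative continuous functions on the spectrum of a
positive operator `A`. -/
noncomputable def cfcVectorFunctional (A : K →L[ℂ] K) (hA : 0 ≤ A) (k : K) :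
    CompactlySupportedContinuousMap (spectrum ℝ≥0 A) ℝ≥0 →ₗ[ℝ≥0] ℝ≥0 where
  toFun f := ⟨RCLike.re (inner ℂ k (cfcHom hA (f : C(spectrum ℝ≥0 A, ℝ≥0)) k)),
    ((ContinuousLinearMap.nonneg_iff_isPositive _).1
      (cfcHom_predicate hA (f : C(spectrum ℝ≥0 A, ℝ≥0)))).re_inner_nonneg_right k⟩
  map_add' f g := by
    apply NNReal.eq
    change RCLike.re (inner ℂ k
        (cfcHom hA ((f : C(spectrum ℝ≥0 A, ℝ≥0)) + (g : C(spectrum ℝ≥0 A, ℝ≥0))) k)) =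
      RCLike.re (inner ℂ k (cfcHom hA (f : C(spectrum ℝ≥0 A, ℝ≥0)) k)) +
        RCLike.re (inner ℂ k (cfcHom hA (g : C(spectrum ℝ≥0 A, ℝ≥0)) k))
    rw [map_add, add_apply, inner_add_right, map_add]
  map_smul' c f := by
    apply NNReal.eq
    change RCLike.re (inner ℂ k (cfcHom hA (c • (f : C(spectrum ℝ≥0 A, ℝ≥0))) k)) =
      c * RCLike.re (inner ℂ k (cfcHom hA (f : C(spectrum ℝ≥0 A, ℝ≥0)) k))
    rw [map_smul]
    change RCLike.re (inner ℂ k (((c : ℝ) : ℂ) • cfcHom hA (f : C(spectrum ℝ≥0 A, ℝ≥0)) k)) = _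
    rw [inner_smul_right]
    exact RCLike.re_ofReal_mul _ _

theorem exists_measure_integral_pow_eq (N : K →L[ℂ] K) [IsStarNormal N] (k : K) :
    ∃ μ : Measure ℝ≥0, IsFiniteMeasure μ ∧ (∃ R : ℝ≥0, ∀ᵐ x ∂μ, x ≤ R) ∧
      ∀ n : ℕ, ∫ x, (x : ℝ) ^ n ∂μ = ‖(N ^ n) k‖ ^ 2 := by
  have hA : 0 ≤ star N * N := star_mul_self_nonneg N
  set A := star N * N with hAdef
  -- Compactness makes every continuous function on the spectrum compactly supported, so the Riesz
  -- measure can be tested on monomials.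
  have : CompactSpace (spectrum ℝ≥0 A) := isCompact_iff_compactSpace.1
    (ContinuousFunctionalCalculus.isCompact_spectrum A)
  let μ₀ := NNRealRMK.rieszMeasure (cfcVectorFunctional A hA k)
  refine ⟨μ₀.map Subtype.val, inferInstance, ?_, fun n => ?_⟩
  · obtain ⟨R, hR⟩ := (ContinuousFunctionalCalculus.isCompact_spectrum (R := ℝ≥0) A).bddAbove
    refine ⟨R, ?_⟩
    rw [ae_map_iff measurable_subtype_coe.aemeasurable measurableSet_Iic]
    exact Filter.Eventually.of_forall fun x => hR x.2
  · rw [integral_map measurable_subtype_coe.aemeasurable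
      (by fun_prop : Measurable fun x : ℝ≥0 => (x : ℝ) ^ n).aestronglyMeasurable]
    let g : C(spectrum ℝ≥0 A, ℝ≥0) := (ContinuousMap.restrict (spectrum ℝ≥0 A) (.id ℝ≥0)) ^ n
    have h := NNRealRMK.integral_rieszMeasure (cfcVectorFunctional A hA k)
      (CompactlySupportedContinuousMap.continuousMapEquiv g)
    have h1 : cfcHom hA g = A ^ n := by rw [map_pow, cfcHom_id]
    have h2 : (cfcVectorFunctional A hA k
        (CompactlySupportedContinuousMap.continuousMapEquiv g) : ℝ) =
        RCLike.re (inner ℂ k ((cfcHom hA g) k)) := rfl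
    rw [h2, h1, inner_star_mul_self_pow] at h
    refine Eq.trans ?_ (h.trans (Complex.ofReal_re _))
    simp [g, μ₀]

end NormalOperator

/-! ### Orbit norms under subnormal extensions -/

theorem norm_weightedShift_pow_stdVec_zero (w : ℕ → ℝ) (hw : ∃ M, ∀ n, |w n| ≤ M) (n : ℕ) :
    ‖((weightedShift w hw) ^ n) (stdVec 0)‖ ^ 2 = formalMoment w n := by
  have h : ((weightedShift w hw) ^ n) (stdVec 0) =
      ((∏ i ∈ Finset.range n, w i : ℝ) : ℂ) • stdVec n := by
    induction n with
    | zero => simp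
    | succ n ih =>
      rw [pow_succ', mul_apply_eq_comp, ih, map_smul, weightedShift_stdVec, smul_smul,
        Finset.prod_range_succ]
      push_cast
      rfl
  have h1 : ‖stdVec n‖ = 1 := by simp [stdVec, lp.norm_single]
  rw [h, norm_smul, h1, mul_one, Complex.norm_real, Real.norm_eq_abs, sq_abs, formalMoment,
    Finset.prod_pow]

section Subnormal

variable {H : Type*} [NormedAddCommGroup H] [InnerProductSpace ℂ H]

theorem norm_pow_apply_eq_of_intertwining {K : Type*} [NormedAddCommGroup K]
    [InnerProductSpace ℂ K] {T : H →L[ℂ] H} {N : K →L[ℂ] K} {J : H →ₗᵢ[ℂ] K}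
    (hJ : ∀ h, N (J h) = J (T h)) (h : H) (n : ℕ) : ‖(N ^ n) (J h)‖ = ‖(T ^ n) h‖ := by
  have : (N ^ n) (J h) = J ((T ^ n) h) := by
    induction n with
    | zero => simp
    | succ n ih => rw [pow_succ', pow_succ', mul_apply_eq_comp, ih, hJ]; rfl
  rw [this, J.norm_map]

theorem IsSubnormalOperator.isCPDOperator {T : H →L[ℂ] H} (hT : IsSubnormalOperator T) :
    IsCPDOperator T := by
  obtain ⟨K, _, _, _, J, N, hN, hJ⟩ := hT
  intro h
  simpa only [norm_pow_apply_eq_of_intertwining hJ] using isCPDSeq_norm_pow_sq N (J h)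

end Subnormal

theorem IsSubnormalOperator.exists_isBergerMeasure {w : ℕ → ℝ} {hw : ∃ M, ∀ n, |w n| ≤ M}
    (hT : IsSubnormalOperator (weightedShift w hw)) : ∃ μ, IsBergerMeasure w μ := by
  obtain ⟨K, _, _, _, J, N, hN, hJ⟩ := hT
  obtain ⟨μ, hfin, hbd, hμ⟩ := exists_measure_integral_pow_eq N (J (stdVec 0))
  exact ⟨μ, hfin, hbd, fun n => by
    rw [hμ, norm_pow_apply_eq_of_intertwining hJ, norm_weightedShift_pow_stdVec_zero]⟩

/-! ### Berger measures and representing triplets -/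

/-- Q_n is the first-order Taylor remainder of xⁿ at 1 divided by (x - 1)². The product form also
covers x = 1. Induction works because Q_{n+1} - Q_n is a geometric sum. -/
theorem polyQ_mul_sub_one_sq (n : ℕ) (x : ℝ) :
    polyQ n x * (x - 1) ^ 2 = x ^ n - 1 - n * (x - 1) := by
  have hstep : ∀ n : ℕ, polyQ (n + 1) x = polyQ n x + ∑ j ∈ Finset.range n, x ^ j := by
    intro n
    cases n with
    | zero => simp [polyQ]
    | succ n =>
      simp only [polyQ, Nat.add_sub_cancel]
      rw [Finset.sum_range_succ, Finset.sum_range_succ _ n, ← add_assoc, ← Finset.sum_add_distrib]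
      push_cast
      congr 1
      · exact Finset.sum_congr rfl fun j _ => by ring
      · ring
  induction n with
  | zero => simp [polyQ]
  | succ n ih =>
    rw [hstep, add_mul, ih]
    have := geom_sum_mul x n
    push_cast
    linear_combination (x - 1) * this

theorem integrable_pow_of_ae_le {μ : Measure ℝ≥0} [IsFiniteMeasure μ] {R : ℝ≥0}
    (hR : ∀ᵐ x ∂μ, x ≤ R) (n : ℕ) : Integrable (fun x : ℝ≥0 => (x : ℝ) ^ n) μ := by
  refine Integrable.of_bound
    (by fun_prop : Measurable fun x : ℝ≥0 => (x : ℝ) ^ n).aestronglyMeasurable ((R : ℝ) ^ n) ?_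
  filter_upwards [hR] with x hx
  rw [Real.norm_of_nonneg (by positivity)]
  gcongr

theorem integrable_sub_one_of_ae_le {μ : Measure ℝ≥0} [IsFiniteMeasure μ] {R : ℝ≥0}
    (hR : ∀ᵐ x ∂μ, x ≤ R) : Integrable (fun x : ℝ≥0 => (x : ℝ) - 1) μ := by
  have h := integrable_pow_of_ae_le hR 1
  simp only [pow_one] at h
  exact h.sub (integrable_const 1)

theorem integral_pow_sub_one_sub {μ : Measure ℝ≥0} [IsFiniteMeasure μ] {R : ℝ≥0}
    (hR : ∀ᵐ x ∂μ, x ≤ R) (n : ℕ) :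
    ∫ x : ℝ≥0, ((x : ℝ) ^ n - 1 - n * ((x : ℝ) - 1)) ∂μ =
      ∫ x : ℝ≥0, (x : ℝ) ^ n ∂μ - ∫ _ : ℝ≥0, (1 : ℝ) ∂μ - n * ∫ x : ℝ≥0, ((x : ℝ) - 1) ∂μ := by
  have h := integrable_pow_of_ae_le hR n
  rw [integral_sub (f := fun x : ℝ≥0 => (x : ℝ) ^ n - 1) (h.sub (integrable_const 1))
      ((integrable_sub_one_of_ae_le hR).const_mul _),
    integral_sub h (integrable_const 1), integral_const_mul]

theorem isCompact_support_of_ae_le {μ : Measure ℝ≥0} {R : ℝ≥0} (hR : ∀ᵐ x ∂μ, x ≤ R) :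
    IsCompact μ.support :=
  (isCompact_Icc (a := 0) (b := R)).of_isClosed_subset Measure.isClosed_support
    (Measure.support_subset_of_isClosed isClosed_Icc
      (by filter_upwards [hR] with x hx using ⟨zero_le, hx⟩))

theorem exists_ae_le_of_isCompact_support {μ : Measure ℝ≥0} (h : IsCompact μ.support) :
    ∃ R : ℝ≥0, ∀ᵐ x ∂μ, x ≤ R := by
  obtain ⟨R, hR⟩ := h.bddAbove
  exact ⟨R, by filter_upwards [Measure.support_mem_ae (μ := μ)] with x hx using hR hx⟩

theorem IsBergerMeasure.isScalarRepresentingTriplet {w : ℕ → ℝ} {μ : Measure ℝ≥0}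
    (h : IsBergerMeasure w μ) :
    ∃ (b c : ℝ) (ν : Measure ℝ≥0), IsScalarRepresentingTriplet w b c ν ∧
      ∫⁻ x, ENNReal.ofReal (1 / ((x : ℝ) - 1) ^ 2) ∂ν ≤ 1 ∧
      b = ∫ x, 1 / ((x : ℝ) - 1) ∂ν ∧ c = 0 := by
  have := h.finite
  obtain ⟨R, hR⟩ := h.bounded
  have hint := integrable_pow_of_ae_le hR
  have hmass : ∫ x : ℝ≥0, (1 : ℝ) ∂μ = 1 := by simpa [formalMoment] using (h.moment 0).symm
  have huniv : μ Set.univ = 1 := by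
    rw [integral_const, smul_eq_mul, mul_one, measureReal_def] at hmass
    rw [← ENNReal.ofReal_toReal (measure_ne_top μ Set.univ), hmass, ENNReal.ofReal_one]
  have hint2 : Integrable (fun x : ℝ≥0 => ((x : ℝ) - 1) ^ 2) μ := by
    refine (((hint 2).sub ((hint 1).const_mul 2)).add (integrable_const (1 : ℝ))).congr ?_
    exact Filter.Eventually.of_forall fun x => by simp; ring
  have hd : Measurable fun x : ℝ≥0 => ENNReal.ofReal (((x : ℝ) - 1) ^ 2) := by fun_prop
  -- This density clears the denominators and vanishes at 1, which removes any atom there.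
  set ν := μ.withDensity fun x : ℝ≥0 => ENNReal.ofReal (((x : ℝ) - 1) ^ 2) with hν
  have hintν : ∀ g : ℝ≥0 → ℝ, ∫ x, g x ∂ν = ∫ x, ((x : ℝ) - 1) ^ 2 * g x ∂μ := by
    intro g
    rw [hν, integral_withDensity_eq_integral_toReal_smul hd (by simp)]
    simp [ENNReal.toReal_ofReal, sq_nonneg]
  have hb : ∫ x : ℝ≥0, 1 / ((x : ℝ) - 1) ∂ν = ∫ x : ℝ≥0, ((x : ℝ) - 1) ∂μ := by
    rw [hintν]
    congr 1 with x
    -- At x = 1 both sides are 0, by the convention 1 / 0 = 0.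
    by_cases hx : (x : ℝ) - 1 = 0
    · simp [hx]
    · field_simp
  refine ⟨_, 0, ν, ⟨le_rfl, isFiniteMeasure_withDensity_ofReal hint2.2, ?_, ?_, ?_⟩, ?_, rfl, rfl⟩
  · exact isCompact_support_of_ae_le
      ((withDensity_absolutelyContinuous μ _).ae_le hR)
  · rw [hν, withDensity_apply _ (measurableSet_singleton 1)]
    simp
  · intro n
    have hQ : ∫ x : ℝ≥0, polyQ n x ∂ν = ∫ x : ℝ≥0, ((x : ℝ) ^ n - 1 - n * ((x : ℝ) - 1)) ∂μ := by
      rw [hintν]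
      congr 1 with x
      rw [mul_comm, polyQ_mul_sub_one_sq]
    rw [hQ, hb, integral_pow_sub_one_sub hR, hmass, ← h.moment]
    ring
  · rw [hν, lintegral_withDensity_eq_lintegral_mul _ hd (by fun_prop), ← huniv,
      ← setLIntegral_univ, ← one_mul (μ Set.univ), ← setLIntegral_const]
    refine lintegral_mono fun x => ?_
    rw [Pi.mul_apply, ← ENNReal.ofReal_mul (sq_nonneg _), ← ENNReal.ofReal_one]
    refine ENNReal.ofReal_le_ofReal ?_
    -- The integrand is t / t with t = (x - 1)²: it is 1 off the point 1 and 0 at it, so the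
    -- integral is at most the total mass 1.
    rw [mul_one_div]
    exact div_self_le_one _

theorem IsScalarRepresentingTriplet.exists_isBergerMeasure {w : ℕ → ℝ} {b : ℝ}
    {ν : Measure ℝ≥0} (h : IsScalarRepresentingTriplet w b 0 ν)
    (hν : ∫⁻ x, ENNReal.ofReal (1 / ((x : ℝ) - 1) ^ 2) ∂ν ≤ 1)
    (hb : b = ∫ x, 1 / ((x : ℝ) - 1) ∂ν) : ∃ μ, IsBergerMeasure w μ := by
  have := h.finite
  obtain ⟨R, hR⟩ := exists_ae_le_of_isCompact_support h.compact_support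
  have hne : ∀ᵐ x : ℝ≥0 ∂ν, (x : ℝ) - 1 ≠ 0 := by
    have : ∀ᵐ x ∂ν, x ≠ 1 := by simpa [ae_iff] using h.no_atom_one
    filter_upwards [this] with x hx
    rw [sub_ne_zero]
    exact_mod_cast hx
  have hd : Measurable fun x : ℝ≥0 => ENNReal.ofReal (1 / ((x : ℝ) - 1) ^ 2) := by fun_prop
  set m := ∫⁻ x, ENNReal.ofReal (1 / ((x : ℝ) - 1) ^ 2) ∂ν with hm
  have hmtop : m ≠ ∞ := ne_top_of_le_ne_top ENNReal.one_ne_top hν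
  set ρ := ν.withDensity fun x : ℝ≥0 => ENNReal.ofReal (1 / ((x : ℝ) - 1) ^ 2) with hρ
  have hρR : ∀ᵐ x ∂ρ, x ≤ R := (withDensity_absolutelyContinuous ν _).ae_le hR
  have hρfin : IsFiniteMeasure ρ := isFiniteMeasure_withDensity hmtop
  have hintρ : ∀ g : ℝ≥0 → ℝ, ∫ x, g x ∂ρ = ∫ x, 1 / ((x : ℝ) - 1) ^ 2 * g x ∂ν := by
    intro g
    rw [hρ, integral_withDensity_eq_integral_toReal_smul hd (by simp)]
    refine integral_congr_ae (Filter.Eventually.of_forall fun x => ?_)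
    beta_reduce
    rw [ENNReal.toReal_ofReal (by positivity), smul_eq_mul]
  have hpow := integrable_pow_of_ae_le hρR
  have hfin : IsFiniteMeasure ((1 - m) • Measure.dirac (1 : ℝ≥0)) :=
    Measure.smul_finite _ (ENNReal.sub_ne_top ENNReal.one_ne_top)
  -- `ρ` has mass `m`, while the zeroth moment must be 1. The atom at 1 adds the constant 1 - m to
  -- every moment; `hν` ensures that the truncated subtraction `1 - m` is a true one.
  refine ⟨ρ + (1 - m) • Measure.dirac 1, inferInstance, ⟨max R 1, ?_⟩, fun n => ?_⟩
  · rw [ae_add_measure_iff]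
    constructor
    · filter_upwards [hρR] with x hx using hx.trans (le_max_left _ _)
    · refine Measure.ae_smul_measure ?_ _
      rw [ae_dirac_iff measurableSet_Iic]
      exact le_max_right _ _
  · have hb' : b = ∫ x : ℝ≥0, ((x : ℝ) - 1) ∂ρ := by
      rw [hb, hintρ]
      refine integral_congr_ae ?_
      filter_upwards [hne] with x hx
      field_simp
    have hQ : ∫ x : ℝ≥0, polyQ n x ∂ν = ∫ x : ℝ≥0, ((x : ℝ) ^ n - 1 - n * ((x : ℝ) - 1)) ∂ρ := by
      rw [hintρ]
      refine integral_congr_ae ?_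
      filter_upwards [hne] with x hx
      rw [← polyQ_mul_sub_one_sq]
      field_simp
    have hmass : ∫ x : ℝ≥0, (1 : ℝ) ∂ρ = m.toReal := by
      rw [integral_const, smul_eq_mul, mul_one, measureReal_def, hρ,
        withDensity_apply _ MeasurableSet.univ, setLIntegral_univ]
    rw [h.moment, hQ, hb', integral_pow_sub_one_sub hρR, hmass,
      integral_add_measure (hpow n) (integrable_pow_of_ae_le (R := 1) ?_ n), integral_smul_measure,
      integral_dirac, ENNReal.toReal_sub_of_le hν ENNReal.one_ne_top]
    · simp
      ring
    · refine Measure.ae_smul_measure ?_ _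
      rw [ae_dirac_iff measurableSet_Iic]

/-! ### The normal model: multiplication on L² -/

section MultiplicationOperator

variable {X : Type*} [MeasurableSpace X] {μ : Measure X}

/-- Multiplication by an essentially bounded function, as an operator on `L²`. -/
noncomputable def mulL2 (f : Lp ℂ ∞ μ) : Lp ℂ 2 μ →L[ℂ] Lp ℂ 2 μ :=
  (ContinuousLinearMap.mul ℂ ℂ).holderL μ ∞ 2 2 f

theorem coeFn_mulL2 (f : Lp ℂ ∞ μ) (g : Lp ℂ 2 μ) :
    mulL2 f g =ᵐ[μ] fun x => f x * g x :=
  (ContinuousLinearMap.mul ℂ ℂ).coeFn_holder f g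

theorem star_mulL2 (f : Lp ℂ ∞ μ) : star (mulL2 f) = mulL2 (star f) := by
  rw [ContinuousLinearMap.star_eq_adjoint, eq_comm, ContinuousLinearMap.eq_adjoint_iff]
  intro g h
  rw [L2.inner_def, L2.inner_def]
  refine integral_congr_ae ?_
  filter_upwards [coeFn_mulL2 (star f) g, coeFn_mulL2 f h, Lp.coeFn_star f] with x h1 h2 h3
  simp only [RCLike.inner_apply, h1, h2, h3, map_mul, Pi.star_apply, RCLike.star_def,
    RCLike.conj_conj]
  ring

theorem mulL2_comm (f g : Lp ℂ ∞ μ) : mulL2 f * mulL2 g = mulL2 g * mulL2 f := by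
  ext1 h
  rw [mul_apply_eq_comp, mul_apply_eq_comp]
  refine Lp.ext ?_
  filter_upwards [coeFn_mulL2 f (mulL2 g h), coeFn_mulL2 g (mulL2 f h), coeFn_mulL2 f h,
    coeFn_mulL2 g h] with x h1 h2 h3 h4
  rw [h1, h2, h3, h4]
  ring

instance isStarNormal_mulL2 (f : Lp ℂ ∞ μ) : IsStarNormal (mulL2 f) :=
  ⟨by rw [star_mulL2]; exact mulL2_comm _ _⟩

end MultiplicationOperator

/-- The coordinate function `√x · e^{2πit}` on `[0, ∞) × ℝ/ℤ`: the complex coordinate in polar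
form, with `x` the square of the modulus. -/
noncomputable def polarCoordinate (p : ℝ≥0 × UnitAddCircle) : ℂ :=
  (Real.sqrt p.1 : ℂ) * fourier 1 p.2

theorem measurable_polarCoordinate : Measurable polarCoordinate := by
  unfold polarCoordinate
  fun_prop

theorem norm_polarCoordinate (p : ℝ≥0 × UnitAddCircle) : ‖polarCoordinate p‖ = Real.sqrt p.1 := by
  rw [polarCoordinate, norm_mul, fourier_apply, Circle.norm_coe, mul_one, Complex.norm_real,
    Real.norm_of_nonneg (Real.sqrt_nonneg _)]

theorem polarCoordinate_pow (p : ℝ≥0 × UnitAddCircle) (n : ℕ) :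
    polarCoordinate p ^ n = (Real.sqrt p.1 : ℂ) ^ n * fourier n p.2 := by
  rw [polarCoordinate, mul_pow]
  congr 1
  rw [fourier_apply, fourier_apply, one_smul, AddCircle.toCircle_zsmul]
  simp

theorem integral_fourier (k : ℤ) :
    ∫ t : UnitAddCircle, fourier k t ∂AddCircle.haarAddCircle = if k = 0 then (1 : ℂ) else 0 := by
  have h := congrFun (fourierCoeff_fourier (T := 1) k) 0
  simpa [fourierCoeff, Pi.single_apply, eq_comm] using h

/-- Fubini splits off the angular factor ∫ e^{2πi(n-m)t} dt, which vanishes unless m = n; then the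
radial factor is √x^{2n} = xⁿ. -/
theorem integral_polarCoordinate_pow_mul_conj (μ : Measure ℝ≥0) [IsFiniteMeasure μ] (m n : ℕ) :
    ∫ p, polarCoordinate p ^ n * (starRingEnd ℂ) (polarCoordinate p ^ m)
      ∂(μ.prod AddCircle.haarAddCircle) = if m = n then ((∫ x, (x : ℝ) ^ n ∂μ : ℝ) : ℂ) else 0 := by
  have h : ∀ p, polarCoordinate p ^ n * (starRingEnd ℂ) (polarCoordinate p ^ m) =
      (fun x : ℝ≥0 => ((Real.sqrt x ^ (n + m) : ℝ) : ℂ)) p.1 *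
        (fun t => fourier ((n : ℤ) - m) t) p.2 := by
    intro p
    rw [polarCoordinate_pow, polarCoordinate_pow]
    beta_reduce
    rw [sub_eq_add_neg, fourier_add, fourier_neg]
    simp only [map_mul, map_pow, Complex.conj_ofReal]
    push_cast
    ring
  rw [integral_congr_ae (Filter.Eventually.of_forall h)]
  refine (integral_prod_mul (μ := μ) (ν := AddCircle.haarAddCircle)
    (fun x : ℝ≥0 => ((Real.sqrt x ^ (n + m) : ℝ) : ℂ))
    (fun t : UnitAddCircle => fourier ((n : ℤ) - m) t)).trans ?_
  rw [integral_fourier, integral_complex_ofReal]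
  by_cases hmn : m = n
  · subst hmn
    simp only [sub_self, if_true, mul_one, ← two_mul, pow_mul]
    congr 2 with x
    rw [Real.sq_sqrt x.coe_nonneg]
  · rw [if_neg (by omega), if_neg hmn, mul_zero]

theorem IsBergerMeasure.isSubnormalOperator {w : ℕ → ℝ} (hpos : ∀ n, 0 < w n)
    (hw : ∃ M, ∀ n, |w n| ≤ M) {μ : Measure ℝ≥0} (h : IsBergerMeasure w μ) :
    IsSubnormalOperator (weightedShift w hw) := by
  have := h.finite
  obtain ⟨R, hR⟩ := h.bounded
  set P : Measure (ℝ≥0 × UnitAddCircle) := μ.prod AddCircle.haarAddCircle with hP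
  have hRP : ∀ᵐ p ∂P, ‖polarCoordinate p‖ ≤ Real.sqrt R := by
    have : ∀ᵐ p ∂P, p.1 ≤ R := Measure.quasiMeasurePreserving_fst.ae hR
    filter_upwards [this] with p hp
    rw [norm_polarCoordinate]
    exact Real.sqrt_le_sqrt hp
  -- Used with q = 2 for the vectors zⁿ and with q = ∞ for the multiplier z.
  have hmem : ∀ (q : ℝ≥0∞) (n : ℕ), MemLp (fun p => polarCoordinate p ^ n) q P := by
    intro q n
    refine MemLp.of_bound (measurable_polarCoordinate.pow_const n).aestronglyMeasurable
      (Real.sqrt R ^ n) ?_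
    filter_upwards [hRP] with p hp
    rw [norm_pow]
    gcongr
  -- `a n` is the norm of zⁿ in L², by which `u` normalises.
  set a : ℕ → ℝ := fun n => ∏ i ∈ Finset.range n, w i with ha
  have hapos : ∀ n, 0 < a n := fun n => Finset.prod_pos fun i _ => hpos i
  have ha2 : ∀ n, formalMoment w n = a n ^ 2 := fun n => Finset.prod_pow _ _ _
  let v : ℕ → Lp ℂ 2 P := fun n => (hmem 2 n).toLp _
  have hv : ∀ m n, inner ℂ (v m) (v n) = if m = n then ((a n ^ 2 : ℝ) : ℂ) else 0 := by
    intro m n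
    rw [← ha2, h.moment, ← integral_polarCoordinate_pow_mul_conj, L2.inner_def]
    refine integral_congr_ae ?_
    filter_upwards [(hmem 2 m).coeFn_toLp, (hmem 2 n).coeFn_toLp] with p h1 h2
    simp only [v, RCLike.inner_apply, h1, h2]
  let u : ℕ → Lp ℂ 2 P := fun n => ((a n)⁻¹ : ℂ) • v n
  have hu : Orthonormal ℂ u := by
    rw [orthonormal_iff_ite]
    intro m n
    simp only [u, inner_smul_left, inner_smul_right, hv]
    split_ifs with hmn
    · subst hmn
      have : (a m : ℂ) ≠ 0 := by exact_mod_cast (hapos m).ne'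
      simp only [map_inv₀, Complex.conj_ofReal]
      push_cast
      field_simp
    · simp
  let f : Lp ℂ ∞ P := (hmem ∞ 1).toLp _
  have hfv : ∀ n, mulL2 f (v n) = v (n + 1) := by
    intro n
    refine Lp.ext ?_
    filter_upwards [coeFn_mulL2 f (v n), (hmem ∞ 1).coeFn_toLp, (hmem 2 n).coeFn_toLp,
      (hmem 2 (n + 1)).coeFn_toLp] with p h1 h2 h3 h4
    rw [h1, h2, h3, h4]
    ring
  have hfu : ∀ n, mulL2 f (u n) = (w n : ℂ) • u (n + 1) := by
    intro n
    simp only [u, map_smul, hfv, smul_smul]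
    congr 1
    have h1 : (a n : ℂ) ≠ 0 := by exact_mod_cast (hapos n).ne'
    have h2 : (w n : ℂ) ≠ 0 := by exact_mod_cast (hpos n).ne'
    have h3 : (a (n + 1) : ℂ) = a n * w n := by
      rw [ha]; beta_reduce; rw [Finset.prod_range_succ]; push_cast; rfl
    rw [h3]
    field_simp
  let J : EllTwo →ₗᵢ[ℂ] Lp ℂ 2 P := hu.orthogonalFamily.linearIsometry
  have hJ : ∀ n, J (stdVec n) = u n := by
    intro n
    simp [J, stdVec, LinearIsometry.toSpanSingleton_apply]
  refine ⟨Lp ℂ 2 P, inferInstance, inferInstance, inferInstance, J, mulL2 f, inferInstance, ?_⟩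
  have hext : (mulL2 f).comp J.toContinuousLinearMap =
      J.toContinuousLinearMap.comp (weightedShift w hw) := by
    -- Bounded operators that agree on the basis vectors are equal.
    refine lp.ext_continuousLinearMap ENNReal.ofNat_ne_top fun n => ?_
    refine ContinuousLinearMap.ext_ring ?_
    change mulL2 f (J (stdVec n)) = J (weightedShift w hw (stdVec n))
    rw [hJ, hfu, weightedShift_stdVec, map_smul, hJ]
  exact fun x => DFunLike.congr_fun hext x

theorem proposition1p7 (w : ℕ → ℝ) (hpos : ∀ n, 0 < w n) (hbdd : ∃ M, ∀ n, |w n| ≤ M) :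
    IsSubnormalOperator (weightedShift w hbdd) ↔
      IsCPDOperator (weightedShift w hbdd) ∧
        ∃ (b c : ℝ) (ν : Measure ℝ≥0), IsScalarRepresentingTriplet w b c ν ∧
          ∫⁻ x, ENNReal.ofReal (1 / ((x : ℝ) - 1) ^ 2) ∂ν ≤ 1 ∧
          b = ∫ x, 1 / ((x : ℝ) - 1) ∂ν ∧
          c = 0 := by
  constructor
  · intro h
    obtain ⟨μ, hμ⟩ := h.exists_isBergerMeasure
    exact ⟨h.isCPDOperator, hμ.isScalarRepresentingTriplet⟩
  · rintro ⟨-, b, c, ν, htrip, hν, hb, rfl⟩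
    obtain ⟨μ, hμ⟩ := htrip.exists_isBergerMeasure hν hb
    exact hμ.isSubnormalOperator hpos hbdd
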